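/- Let $n\ge 0$ and $t\ge 1$ be integers, put $\tau=\lfloor (t+1)/2\rfloor$, and let $M$ be a Hermitian matrix acting on $\mathbb C^n\otimes\mathbb C^n$. Notation. $\langle X,Y\rangle=\operatorname{Tr}(X^*Y)$ is the trace inner product, and $\mathrm{Herm}(V)$ is the real space of Hermitian matrices acting on $V$. A matrix $\rho$ acting on $\mathbb C^n\otimes(\mathbb C^n)^{\otimes t}=(\mathbb C^n)^{\otimes(t+1)}$ has entries $\rho_{\underline i,\underline j}$ with $\underline i=(i_0,i_1,\dots,i_t)$, $\underline j=(j_0,\dots,j_t)\in[n]^{t+1}$; position $0$ is the A-register and positions $1,\dots,t$ are the B-registers. - $\mathrm{BS}((\mathbb C^n)^{\otimes (t+1)})\simeq \mathrm{Herm}(S^{t+1}(\mathbb C^n))$ is the set of Bose symmetric Hermitian matrices, i.e. those $\rho\in\mathrm{Herm}((\mathbb C^n)^{\otimes(t+1)})$ with $\rho_{\underline i,\underline j^\sigma}=\rho_{\underline i,\underline j}$ for all $\underline i,\underline j$ and all permutations $\sigma$ of the $t+1$ positions, where $\underline j^\sigma=(j_{\sigma(0)},\dots,j_{\sigma(t)})$.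 Its orthogonal complement in $\mathrm{Herm}((\mathbb C^n)^{\otimes (t+1)})$ for $\langle\cdot,\cdot\rangle$ is denoted $\mathrm{Herm}(S^{t+1}(\mathbb C^n))^\perp$. - $\rho^{T_{B[s]}}$ ($0\le s\le t$) is the partial transpose of $\rho$ with respect to the B-registers $1,\dots,s$, that is, its $(\underline i,\underline j)$-entry is the entry of $\rho$ obtained by exchanging $i_r$ and $j_r$ for $1\le r\le s$. Put $\mathcal W^{(t)}_{n,s}=\{\rho\in\mathrm{Herm}((\mathbb C^n)^{\otimes(t+1)}):\rho^{T_{B[s]}}\succeq 0\}$. - $\operatorname{Tr}_{B[2:t]}$ is the partial trace over the B-registers $2,\dots,t$. - $\widetilde{\mathrm{DPS}}^{(t)}_n$ is the set of all $\rho_{AB}\in\mathrm{Herm}(\mathbb C^n\otimes\mathbb C^n)$ for which there is $\rho\in\mathrm{BS}((\mathbb C^n)^{\otimes(t+1)})$ with $\rho^{T_{B[s]}}\succeq0$ for $s=0,1,\dots,\tau$ and $\operatorname{Tr}_{B[2:t]}(\rho)=\rho_{AB}$. Its dual cone is $(\widetilde{\mathrm{DPS}}^{(t)}_n)^*=\{N\in\mathrm{Herm}(\mathbb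 C^n\otimes\mathbb C^n):\langle N,\rho_{AB}\rangle\ge0\ \text{for all }\rho_{AB}\in\widetilde{\mathrm{DPS}}^{(t)}_n\}$. - A polynomial $p\in\mathbb C[x,\overline x]$, where $x=(x_1,\dots,x_n)$ and $\overline x=(\overline x_1,\dots,\overline x_n)$, is Hermitian if $p=\overline p$ (conjugate the coefficients and exchange $x_i$ and $\overline x_i$), and it is r-sos if $p=\sum_{\ell=1}^m q_\ell^2$ for finitely many Hermitian polynomials $q_\ell\in\mathbb C[x,\overline x]$. Finally, $\|x\|^2=\sum_{i=1}^n x_i\overline x_i$. Theorem. The following assertions are equivalent. (i) $M\in(\widetilde{\mathrm{DPS}}^{(t)}_n)^*$. (ii) The polynomial $\|x\|^{2(t-1)}\,\langle M,\,xx^*\otimes xx^*\rangle\in\mathbb C[x,\overline x]$ is r-sos. (iii) There exist matrices $B,W_0,W_1,\dots,W_\tau\in\mathrm{Herm}(\mathbb C^n\otimes(\mathbb C^n)^{\otimes t})$ such that $$M\otimes I_n^{\otimes(t-1)}=B+\sum_{s=0}^{\tau}W_s,$$ where $B\in\mathrm{Herm}(S^{t+1}(\mathbb C^n))^\perp$ and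 $W_s\in\mathcal W^{(t)}_{n,s}$ for $s=0,1,\dots,\tau$. -/

import Mathlib

open scoped ComplexOrder

noncomputable section

namespace BoseDPS

/-- Matrices acting on `ℂ^n ⊗ ℂ^n`, with rows and columns indexed by pairs in `[n] × [n]`. -/
abbrev BipMat (n : ℕ) : Type := Matrix (Fin n × Fin n) (Fin n × Fin n) ℂ

/-- Matrices acting on `(ℂ^n)^{⊗k}`, with rows and columns indexed by sequences in `[n]^k`.
For `k = t + 1` this is `ℂ^n ⊗ (ℂ^n)^{⊗t}`: position `0` is the A-register and the positions
`1, …, t` are the B-registers. -/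
abbrev TensorMat (n k : ℕ) : Type := Matrix (Fin k → Fin n) (Fin k → Fin n) ℂ

/-- The trace inner product `⟨X, Y⟩ = Tr(X^* Y)`, as a real number. (Between Hermitian matrices
the complex number `Tr(X^* Y)` is real.) -/
def traceInner {ι : Type*} [Fintype ι] (X Y : Matrix ι ι ℂ) : ℝ :=
  (Matrix.trace (X.conjTranspose * Y)).re

/-- The dual cone, with respect to the trace inner product, inside the space of Hermitian
matrices. -/
def dualCone {ι : Type*} [Fintype ι] (K : Set (Matrix ι ι ℂ)) : Set (Matrix ι ι ℂ) :=
  {M | M.IsHermitian ∧ ∀ ρ ∈ K, 0 ≤ traceInner M ρ}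

/-- The orthogonal complement, with respect to the trace inner product, inside the space of
Hermitian matrices. -/
def hermPerp {ι : Type*} [Fintype ι] (V : Set (Matrix ι ι ℂ)) : Set (Matrix ι ι ℂ) :=
  {B | B.IsHermitian ∧ ∀ ρ ∈ V, traceInner B ρ = 0}

/-- The space `BS((ℂ^n)^{⊗k}) ≃ Herm(S^k(ℂ^n))` of Hermitian Bose symmetric matrices:
`ρ (e_{j_1} ⊗ ⋯ ⊗ e_{j_k}) = ρ (e_{j_{σ(1)}} ⊗ ⋯ ⊗ e_{j_{σ(k)}})` for all permutations `σ`. -/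
def boseSym (n k : ℕ) : Set (TensorMat n k) :=
  {ρ | ρ.IsHermitian ∧
    ∀ (σ : Equiv.Perm (Fin k)) (i j : Fin k → Fin n), ρ i (fun r => j (σ r)) = ρ i j}

/-- The partial transpose `T_{B[s]}` with respect to the first `s` B-registers, i.e. the registers
at the positions `1, …, s`. -/
def partialTranspose {n t : ℕ} (s : ℕ) (ρ : TensorMat n (t + 1)) : TensorMat n (t + 1) :=
  Matrix.of fun i j =>
    ρ (fun r => if 1 ≤ r.val ∧ r.val ≤ s then j r else i r)
      (fun r => if 1 ≤ r.val ∧ r.val ≤ s then i r else j r)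

/-- The sequence in `[n]^{t+1}` (for `t ≥ 1`) obtained by concatenating `i_0 i_1` with
`k ∈ [n]^{t-1}`. -/
def concat {n t : ℕ} (i : Fin n × Fin n) (k : Fin (t - 1) → Fin n) : Fin (t + 1) → Fin n :=
  fun r =>
    if h0 : r.val = 0 then i.1
    else if h1 : r.val = 1 then i.2
    else k ⟨r.val - 2, by omega⟩

/-- The partial trace `Tr_{B[2:t]}` (for `t ≥ 1`), which traces out all the registers except
the A-register and the first B-register. -/
def partialTrace {n t : ℕ} (ρ : TensorMat n (t + 1)) : BipMat n :=
  Matrix.of fun i j => ∑ k : Fin (t - 1) → Fin n, ρ (concat i k) (concat j k)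

/-- The matrix `M ⊗ I_n^{⊗(t-1)}` (for `t ≥ 1`), with `M` acting on the registers `0` and `1`. -/
def tensorId {n : ℕ} (t : ℕ) (M : BipMat n) : TensorMat n (t + 1) :=
  Matrix.of fun i j =>
    M (i 0, i 1) (j 0, j 1) *
      ∏ r : Fin (t - 1),
        (1 : Matrix (Fin n) (Fin n) ℂ) (i ⟨r.val + 2, by omega⟩) (j ⟨r.val + 2, by omega⟩)

/-- The cone `W^{(t)}_{n,s}` of Hermitian matrices with `ρ^{T_{B[s]}} ⪰ 0`. -/
def coneW (n t s : ℕ) : Set (TensorMat n (t + 1)) :=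
  {ρ | ρ.IsHermitian ∧ (partialTranspose s ρ).PosSemidef}

/-- The symmetric DPS relaxation of order `t ≥ 1`. -/
def symDPS (n t : ℕ) : Set (BipMat n) :=
  {ρ | ρ.IsHermitian ∧ ∃ R ∈ boseSym n (t + 1),
    (∀ s ≤ (t + 1) / 2, (partialTranspose s R).PosSemidef) ∧ ρ = partialTrace R}

/-- The polynomial ring `ℂ[x, x̄]`; `Sum.inl i` stands for `x_i` and `Sum.inr i` for `x̄_i`. -/
abbrev CPoly (n : ℕ) : Type := MvPolynomial (Fin n ⊕ Fin n) ℂ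

/-- The variable `x_i`. -/
def var {n : ℕ} (i : Fin n) : CPoly n := MvPolynomial.X (Sum.inl i)

/-- The variable `x̄_i`. -/
def varBar {n : ℕ} (i : Fin n) : CPoly n := MvPolynomial.X (Sum.inr i)

/-- The conjugate `p̄` of `p`: conjugate the coefficients and exchange `x_i` and `x̄_i`. -/
def polyConj {n : ℕ} (p : CPoly n) : CPoly n :=
  MvPolynomial.rename Sum.swap (MvPolynomial.map (starRingEnd ℂ) p)

/-- `p` is a real sum of squares: a finite sum of squares of Hermitian polynomials. -/
def IsRSOS {n : ℕ} (p : CPoly n) : Prop :=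
  ∃ (m : ℕ) (q : Fin m → CPoly n), (∀ l, polyConj (q l) = q l) ∧ p = ∑ l, q l ^ 2

/-- The polynomial `‖x‖^2 = ∑ x_i x̄_i`. -/
def normSqPoly (n : ℕ) : CPoly n := ∑ i : Fin n, var i * varBar i

/-- The polynomial `⟨M, xx^* ⊗ xx^*⟩`. Recall `⟨X, Y⟩ = ∑ conj(X_{ij}) Y_{ij}` and
`(xx^* ⊗ xx^*)_{i_1 i_2, j_1 j_2} = x_{i_1} x̄_{j_1} x_{i_2} x̄_{j_2}`. -/
def formPoly {n : ℕ} (M : BipMat n) : CPoly n :=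
  ∑ i : Fin n × Fin n, ∑ j : Fin n × Fin n,
    MvPolynomial.C (starRingEnd ℂ (M i j)) *
      ((var i.1 * varBar j.1) * (var i.2 * varBar j.2))

end BoseDPS

end

/-! Everything is translated into polynomials by `matPoly`. A Bose symmetric `R` is the moment
matrix of a Hermitian functional `F` in bidegree `(t+1, t+1)`, and the trace pairing with `X` is the
real part of `F (matPoly X)` (`traceInner_eq_re_apply_matPoly`). Under this dictionary `M ⊗ I`
becomes the polynomial of (ii), and positivity of the `s`-th partial transpose becomes `F (u ū) ≥ 0`
for all `u` of bidegree `(t+1-s, s)` (`apply_partialForm_mul_polyConj`). So (i) says that every `F`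
nonnegative on `squareCone` is nonnegative at this polynomial.

The cone has a compact base avoiding zero, hence is closed, and separation puts the polynomial in
the cone (`mem_squareCone_of_dual`). A generator `u ū` is a sum of two Hermitian squares, which
gives (ii); it is also `matPoly` of a partially transposed rank-one matrix, which gives (iii), with
`B` absorbing the kernel of `matPoly`.

From (iii) back to (i), each `W_s` pairs nonnegatively with `R`. From (ii) to (i), homogeneity
removes the low-degree terms of the `q_l` and `F` ignores the high ones, so each `q_l` may be taken
homogeneous of degree `t+1`. Its square is then seen by `F` only through products of conjugate
bidegree components, and one component of each conjugate pair has `s ≤ (t+1)/2`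
(`momentFunctional_sq_nonneg_of_isHomogeneous`). -/

noncomputable section

namespace BoseDPS

open MvPolynomial

variable {n t k : ℕ}

/-! ### Conjugation and evaluation of polynomials in `x` and `x̄` -/

/-- Conjugation of polynomials as a ring homomorphism. -/
def polyConjHom (n : ℕ) : CPoly n →+* CPoly n :=
  (rename Sum.swap).toRingHom.comp (map (starRingEnd ℂ))

lemma polyConjHom_apply (p : CPoly n) : polyConjHom n p = polyConj p := rfl

lemma polyConj_add (p q : CPoly n) : polyConj (p + q) = polyConj p + polyConj q :=
  map_add (polyConjHom n) p q

lemma polyConj_mul (p q : CPoly n) : polyConj (p * q) = polyConj p * polyConj q :=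
  map_mul (polyConjHom n) p q

lemma polyConj_sum {α : Type*} (s : Finset α) (f : α → CPoly n) :
    polyConj (∑ a ∈ s, f a) = ∑ a ∈ s, polyConj (f a) :=
  map_sum (polyConjHom n) f s

lemma polyConj_prod {α : Type*} (s : Finset α) (f : α → CPoly n) :
    polyConj (∏ a ∈ s, f a) = ∏ a ∈ s, polyConj (f a) :=
  map_prod (polyConjHom n) f s

lemma polyConj_smul (c : ℂ) (p : CPoly n) :
    polyConj (c • p) = starRingEnd ℂ c • polyConj p := by
  simp [polyConj, smul_eq_C_mul]

@[simp] lemma polyConj_C (c : ℂ) : polyConj (C c : CPoly n) = C (starRingEnd ℂ c) := by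
  simp [polyConj]

@[simp] lemma polyConj_var (i : Fin n) : polyConj (var i) = varBar i := by
  simp [polyConj, var, varBar]

@[simp] lemma polyConj_varBar (i : Fin n) : polyConj (varBar i) = var i := by
  simp [polyConj, var, varBar]

@[simp] lemma polyConj_polyConj (p : CPoly n) : polyConj (polyConj p) = p := by
  induction p using MvPolynomial.induction_on with
  | C a => simp
  | add p q hp hq => rw [polyConj_add, polyConj_add, hp, hq]
  | mul_X p i hp =>
    rw [polyConj_mul, polyConj_mul, hp]
    congr 1
    cases i <;> simp [polyConj]

lemma coeff_polyConj (p : CPoly n) (m : Fin n ⊕ Fin n →₀ ℕ) :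
    coeff m (polyConj p) = starRingEnd ℂ (coeff (m.mapDomain Sum.swap) p) := by
  have h : m = (m.mapDomain Sum.swap).mapDomain Sum.swap := by
    rw [← Finsupp.mapDomain_comp, Sum.swap_swap_eq, Finsupp.mapDomain_id]
  conv_lhs => rw [h]
  rw [polyConj, coeff_rename_mapDomain _ (Sum.swap_leftInverse.injective), coeff_map]

/-- Evaluation of a polynomial in `x` and `x̄` at a point of `ℂ^n`. -/
def evalAt (z : Fin n → ℂ) : CPoly n →+* ℂ :=
  eval (Sum.elim z fun i => starRingEnd ℂ (z i))

lemma evalAt_smul (z : Fin n → ℂ) (c : ℂ) (p : CPoly n) :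
    evalAt z (c • p) = c * evalAt z p := by
  simp [evalAt]

lemma evalAt_polyConj (z : Fin n → ℂ) (p : CPoly n) :
    evalAt z (polyConj p) = starRingEnd ℂ (evalAt z p) := by
  induction p using MvPolynomial.induction_on with
  | C a => simp [evalAt]
  | add p q hp hq => rw [polyConj_add, map_add, map_add, map_add, hp, hq]
  | mul_X p i hp =>
    rw [polyConj_mul, map_mul, map_mul, map_mul, hp]
    congr 1
    cases i <;> simp [polyConj, evalAt]

/-- A polynomial in `x` and `x̄` is determined by its values on `ℂ^n`. -/
lemma eq_zero_of_evalAt_eq_zero {p : CPoly n} (h : ∀ z, evalAt z p = 0) : p = 0 := by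
  -- Substitute `x = a + ib`, `x̄ = a - ib` with `a`, `b` as new variables: the result vanishes at
  -- all real points, hence identically. The substitution is invertible over `ℂ`, so `p` itself
  -- vanishes.
  let g : Fin n ⊕ Fin n → CPoly n :=
    Sum.elim (fun i => var i + C Complex.I * varBar i) fun i => var i - C Complex.I * varBar i
  have key : bind₁ g p = 0 := by
    refine MvPolynomial.funext_set (s := fun _ => Set.range ((↑) : ℝ → ℂ))
      (fun _ => Set.infinite_range_of_injective Complex.ofReal_injective) fun x hx => ?_
    have hx' : ∀ k, starRingEnd ℂ (x k) = x k := fun k => by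
      obtain ⟨r, hr⟩ := hx k (Set.mem_univ k)
      rw [← hr, Complex.conj_ofReal]
    have hz := h fun i => x (Sum.inl i) + Complex.I * x (Sum.inr i)
    rw [evalAt] at hz
    rw [map_zero, ← hz, ← MvPolynomial.aeval_eq_eval, aeval_bind₁]
    rw [← MvPolynomial.aeval_eq_eval]
    congr 1
    congr 1
    funext k
    cases k <;> simp [g, var, varBar, hx', sub_eq_add_neg]
  refine MvPolynomial.funext fun x => ?_
  have h2 := congrArg (eval (Sum.elim
    (fun i => (x (Sum.inl i) + x (Sum.inr i)) / 2)
    fun i => (x (Sum.inl i) - x (Sum.inr i)) / (2 * Complex.I))) key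
  rw [map_zero, ← MvPolynomial.aeval_eq_eval, aeval_bind₁] at h2
  rw [map_zero, ← h2, ← MvPolynomial.aeval_eq_eval]
  congr 1
  congr 1
  funext k
  have hI := Complex.I_ne_zero
  cases k <;> simp [g, var, varBar] <;> field_simp <;> ring

lemma evalAt_mul_polyConj (z : Fin n → ℂ) (p : CPoly n) :
    evalAt z (p * polyConj p) = (Complex.normSq (evalAt z p) : ℂ) := by
  rw [map_mul, evalAt_polyConj, Complex.mul_conj]

/-- Sums of squares of Hermitian polynomials are formally real. -/
lemma eq_zero_of_sum_sq_eq_zero {α : Type*} {s : Finset α} {q : α → CPoly n}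
    (hq : ∀ l ∈ s, polyConj (q l) = q l) (h : ∑ l ∈ s, q l ^ 2 = 0) : ∀ l ∈ s, q l = 0 := by
  intro l hl
  refine eq_zero_of_evalAt_eq_zero fun z => ?_
  have h2 := congrArg (evalAt z) h
  have h3 : ∀ k ∈ s, evalAt z (q k ^ 2) = (Complex.normSq (evalAt z (q k)) : ℂ) := fun k hk => by
    rw [← evalAt_mul_polyConj, hq k hk, sq]
  rw [map_sum, map_zero, Finset.sum_congr rfl h3, ← Complex.ofReal_sum, Complex.ofReal_eq_zero,
    Finset.sum_eq_zero_iff_of_nonneg fun _ _ => Complex.normSq_nonneg _] at h2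
  exact Complex.normSq_eq_zero.mp (h2 l hl)

/-! ### Cones over compact sets -/

section Cone

variable {E : Type*} [NormedAddCommGroup E] [NormedSpace ℝ E]

lemma sum_eq_sum_embedding {α β F : Type*} [Fintype α] [Fintype β] [AddCommMonoid F] (g : α ↪ β)
    {a : β → F} (ha : ∀ k, k ∉ Set.range g → a k = 0) : ∑ k, a k = ∑ i, a (g i) :=
  (Finset.sum_of_injOn g g.injective.injOn (by simp)
    (fun k _ hk => ha k (by simpa using hk)) fun _ _ => rfl).symm

-- By Carathéodory, `dim E + 1` points suffice, so the hull is a continuous image of a simplex times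
-- a power of `s`.
open Module in
lemma isCompact_convexHull [FiniteDimensional ℝ E] {s : Set E} (hs : IsCompact s) :
    IsCompact (convexHull ℝ s) := by
  rcases s.eq_empty_or_nonempty with rfl | ⟨e, he⟩
  · simp
  let N := finrank ℝ E + 1
  have hc : IsCompact ((fun p : (Fin N → ℝ) × (Fin N → E) => ∑ k, p.1 k • p.2 k) ''
      (stdSimplex ℝ (Fin N) ×ˢ Set.pi Set.univ fun _ => s)) := by
    refine ((isCompact_stdSimplex ℝ (Fin N)).prod (isCompact_univ_pi fun _ => hs)).image ?_
    fun_prop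
  convert hc using 1
  refine Set.Subset.antisymm (fun x hx => ?_) ?_
  · obtain ⟨ι, _, z, w, hz, hind, hw, hw1, hx⟩ := eq_pos_convex_span_of_mem_convexHull hx
    have hcard : Fintype.card ι ≤ Fintype.card (Fin N) := by
      rw [Fintype.card_fin]
      exact hind.card_le_finrank_succ.trans (Nat.succ_le_succ (Submodule.finrank_le _))
    obtain ⟨g⟩ := Function.Embedding.nonempty_of_card_le hcard
    -- Pad a shorter combination to length `N` with weight `0` at the base point `e`.
    refine ⟨(Function.extend g w (fun _ => 0), Function.extend g z fun _ => e), ⟨⟨?_, ?_⟩, ?_⟩, ?_⟩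
    · intro k
      by_cases hk : k ∈ Set.range g
      · obtain ⟨i, rfl⟩ := hk
        simpa [g.injective.extend_apply] using (hw i).le
      · simp only [Function.extend_apply' _ _ _ hk]; exact le_rfl
    · rw [sum_eq_sum_embedding g fun k hk => Function.extend_apply' w (fun _ => 0) k hk]
      simpa [g.injective.extend_apply] using hw1
    · intro k _
      by_cases hk : k ∈ Set.range g
      · obtain ⟨i, rfl⟩ := hk
        simpa [g.injective.extend_apply] using hz ⟨i, rfl⟩
      · simpa only [Function.extend_apply' _ _ _ hk] using he
    · change ∑ k, Function.extend g w (fun _ => 0) k • Function.extend g z (fun _ => e) k = x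
      rw [sum_eq_sum_embedding g fun k hk => by rw [Function.extend_apply' _ _ _ hk, zero_smul]]
      simpa [g.injective.extend_apply] using hx
  · rintro _ ⟨⟨w, z⟩, ⟨⟨hw, hw1⟩, hz⟩, rfl⟩
    exact (convex_convexHull ℝ s).sum_mem (fun k _ => hw k) hw1
      fun k _ => subset_convexHull ℝ s (hz k (Set.mem_univ k))

/-- Since `K` stays at distance `δ` from zero, elements of the cone within distance 1 of `x` have
scalars at most `(‖x‖ + 1) / δ`. Near `x` the cone thus agrees with a compact set. -/
lemma isClosed_nonneg_smul {K : Set E} (hK : IsCompact K) (h0 : (0 : E) ∉ K) :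
    IsClosed {x : E | ∃ c : ℝ, 0 ≤ c ∧ ∃ k ∈ K, c • k = x} := by
  obtain ⟨δ, hδ, hδK⟩ : ∃ δ > 0, ∀ k ∈ K, δ ≤ ‖k‖ := by
    rcases K.eq_empty_or_nonempty with rfl | hne
    · exact ⟨1, one_pos, by simp⟩
    · obtain ⟨k, hk, hmin⟩ := hK.exists_isMinOn hne continuous_norm.continuousOn
      exact ⟨‖k‖, norm_pos_iff.mpr (fun h => h0 (h ▸ hk)), fun y hy => hmin hy⟩
  refine isClosed_of_closure_subset fun x hx => ?_
  have hc : IsCompact ((fun p : ℝ × E => p.1 • p.2) '' (Set.Icc 0 ((‖x‖ + 1) / δ) ×ˢ K)) :=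
    (isCompact_Icc.prod hK).image (by fun_prop)
  have hx2 : x ∈ closure ((fun p : ℝ × E => p.1 • p.2) '' (Set.Icc 0 ((‖x‖ + 1) / δ) ×ˢ K)) := by
    rw [Metric.mem_closure_iff] at hx ⊢
    intro ε hε
    obtain ⟨y, ⟨c, hc0, k, hk, rfl⟩, hy⟩ := hx (min ε 1) (lt_min hε one_pos)
    refine ⟨c • k, ⟨(c, k), ⟨⟨hc0, ?_⟩, hk⟩, rfl⟩, hy.trans_le (min_le_left _ _)⟩
    rw [le_div_iff₀ hδ]
    have h1 : ‖c • k‖ ≤ ‖x‖ + 1 := by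
      have := norm_le_norm_add_norm_sub' (c • k) x
      rw [← dist_eq_norm, dist_comm] at this
      linarith [hy.trans_le (min_le_right _ _)]
    rw [norm_smul, Real.norm_of_nonneg hc0] at h1
    exact (mul_le_mul_of_nonneg_left (hδK k hk) hc0).trans h1
  rw [hc.isClosed.closure_eq] at hx2
  obtain ⟨⟨c, k⟩, ⟨hc0, hk⟩, rfl⟩ := hx2
  exact ⟨c, hc0.1, k, hk, rfl⟩

lemma convex_nonneg_smul {K : Set E} (hK : Convex ℝ K) :
    Convex ℝ {x : E | ∃ c : ℝ, 0 ≤ c ∧ ∃ k ∈ K, c • k = x} := by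
  rintro _ ⟨c, hc, k, hk, rfl⟩ _ ⟨d, hd, l, hl, rfl⟩ a b ha hb -
  have h1 := mul_nonneg ha hc
  have h2 := mul_nonneg hb hd
  rcases (add_nonneg h1 h2).eq_or_lt with h | h
  · refine ⟨0, le_rfl, k, hk, ?_⟩
    have h3 : a * c = 0 := by linarith
    have h4 : b * d = 0 := by linarith
    simp [smul_smul, h3, h4]
  · refine ⟨_, h.le, _, hK hk hl (div_nonneg h1 h.le) (div_nonneg h2 h.le)
      (by rw [← add_div, div_self h.ne']), ?_⟩
    simp only [smul_add, smul_smul]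
    rw [mul_div_cancel₀ _ h.ne', mul_div_cancel₀ _ h.ne']

/-- Separation of a point from the closed convex cone generated by a compact set. -/
lemma exists_dual_separating [FiniteDimensional ℝ E] {s : Set E} (hs : IsCompact s)
    (h0 : (0 : E) ∉ convexHull ℝ s)
    {x : E} (hx0 : x ≠ 0) (hx : ∀ c : ℝ, 0 ≤ c → ∀ k ∈ convexHull ℝ s, c • k ≠ x) :
    ∃ f : E →L[ℝ] ℝ, (∀ y ∈ s, 0 ≤ f y) ∧ f x < 0 := by
  rcases s.eq_empty_or_nonempty with rfl | ⟨e, he⟩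
  · obtain ⟨f, hf⟩ := geometric_hahn_banach_point_point hx0
    exact ⟨f, by simp, by simpa using hf⟩
  · obtain ⟨f, u, hu, hf⟩ := geometric_hahn_banach_point_closed
      (convex_nonneg_smul (convex_convexHull ℝ s))
      (isClosed_nonneg_smul (isCompact_convexHull hs) h0) (x := x)
      (by rintro ⟨c, hc, k, hk, h⟩; exact hx c hc k hk h)
    have hs' := subset_convexHull ℝ s
    have hu0 : u < 0 := by simpa using hf _ ⟨0, le_rfl, e, hs' he, rfl⟩
    refine ⟨f, fun y hy => ?_, hu.trans hu0⟩
    by_contra! hlt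
    -- Rescaling `y` by the positive number `u / f y` gives a cone element where `f` equals `u`,
    -- against the strict separation.
    have := hf _ ⟨u / f y, (div_pos_of_neg_of_neg hu0 hlt).le, y, hs' hy, rfl⟩
    rw [map_smul, smul_eq_mul, div_mul_cancel₀ _ hlt.ne] at this
    exact lt_irrefl _ this

end Cone

/-! ### Bihomogeneous monomials and Bose symmetric matrices -/

/-- The exponent of the monomial `∏ x_{i_r} ∏ x̄_{j_r}`. -/
def pairExp (i j : Fin k → Fin n) : Fin n ⊕ Fin n →₀ ℕ :=
  ∑ r, Finsupp.single (Sum.inl (i r)) 1 + ∑ r, Finsupp.single (Sum.inr (j r)) 1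

/-- The monomial `∏ x_{i_r} ∏ x̄_{j_r}`. -/
def pairMono (i j : Fin k → Fin n) : CPoly n := (∏ r, var (i r)) * ∏ r, varBar (j r)

lemma pairMono_eq_monomial (i j : Fin k → Fin n) : pairMono i j = monomial (pairExp i j) 1 := by
  have h : ∀ c : Fin k → Fin n ⊕ Fin n,
      ∏ r, (X (c r) : CPoly n) = monomial (∑ r, Finsupp.single (c r) 1) 1 := fun c => by
    rw [monomial_sum_one]; rfl
  have h1 := h fun r => Sum.inl (i r)
  have h2 := h fun r => Sum.inr (j r)
  rw [pairMono, pairExp, ← one_mul (1 : ℂ), ← monomial_mul, ← h1, ← h2]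
  rfl

lemma polyConj_pairMono (i j : Fin k → Fin n) : polyConj (pairMono i j) = pairMono j i := by
  simp [pairMono, polyConj_mul, polyConj_prod, mul_comm]

lemma pairExp_inl (i j : Fin k → Fin n) (a : Fin n) :
    pairExp i j (Sum.inl a) = Fintype.card {r // i r = a} := by
  simp [pairExp, Finsupp.single_apply, Fintype.card_subtype]

lemma pairExp_inr (i j : Fin k → Fin n) (a : Fin n) :
    pairExp i j (Sum.inr a) = Fintype.card {r // j r = a} := by
  simp [pairExp, Finsupp.single_apply, Fintype.card_subtype]

lemma exists_perm_of_card_fiber_eq {α β : Type*} [Fintype α] [DecidableEq β] {f g : α → β}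
    (h : ∀ b, Fintype.card {a // f a = b} = Fintype.card {a // g a = b}) :
    ∃ σ : Equiv.Perm α, f = fun a => g (σ a) :=
  ⟨Equiv.ofFiberEquiv fun b => Fintype.equivOfCardEq (h b),
    funext fun a => (Equiv.ofFiberEquiv_map _ a).symm⟩

/-- A commutative monomial remembers each index sequence only up to order, and the two orders are
independent. -/
lemma exists_perm_of_pairExp_eq {i j i' j' : Fin k → Fin n} (h : pairExp i j = pairExp i' j') :
    (∃ σ : Equiv.Perm (Fin k), i = fun r => i' (σ r)) ∧
      ∃ σ : Equiv.Perm (Fin k), j = fun r => j' (σ r) := by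
  constructor
  · refine exists_perm_of_card_fiber_eq fun a => ?_
    rw [← pairExp_inl i j, h, pairExp_inl]
  · refine exists_perm_of_card_fiber_eq fun a => ?_
    rw [← pairExp_inr i j, h, pairExp_inr]

/-- The number of conjugated variables in a monomial. -/
def barWeight : Fin n ⊕ Fin n → ℕ := Sum.elim (fun _ => 0) fun _ => 1

lemma weight_barWeight_pairExp (i j : Fin k → Fin n) :
    Finsupp.weight barWeight (pairExp i j) = k := by
  simp [pairExp, map_add, map_sum, Finsupp.weight_single, barWeight]

lemma degree_pairExp (i j : Fin k → Fin n) : Finsupp.degree (pairExp i j) = 2 * k := by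
  simp [pairExp, map_add, map_sum, two_mul]

/-- Bose symmetry is imposed on column indices only; Hermitian symmetry transfers it to rows. This
makes the functional attached to `R` independent of the chosen index sequences. -/
lemma boseSym_apply_eq {R : TensorMat n k} (hR : R ∈ boseSym n k) {i j i' j' : Fin k → Fin n}
    (h : pairExp i j = pairExp i' j') : R i j = R i' j' := by
  obtain ⟨⟨σ, rfl⟩, ⟨σ', rfl⟩⟩ := exists_perm_of_pairExp_eq h
  rw [hR.2, ← hR.1.apply, hR.2, hR.1.apply]

open Classical in
/-- The linear functional on polynomials with moment matrix `R`, vanishing on all monomials which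
are not bihomogeneous of bidegree `(k, k)`. -/
def momentFunctional (R : TensorMat n k) : CPoly n →ₗ[ℂ] ℂ :=
  (basisMonomials _ ℂ).constr ℂ fun m =>
    if h : ∃ p : (Fin k → Fin n) × (Fin k → Fin n), pairExp p.1 p.2 = m then
      R h.choose.1 h.choose.2 else 0

lemma momentFunctional_pairMono {R : TensorMat n k} (hR : R ∈ boseSym n k)
    (i j : Fin k → Fin n) : momentFunctional R (pairMono i j) = R i j := by
  have h : ∃ p : (Fin k → Fin n) × (Fin k → Fin n), pairExp p.1 p.2 = pairExp i j := ⟨(i, j), rfl⟩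
  have hb := (basisMonomials (Fin n ⊕ Fin n) ℂ).constr_basis ℂ (fun m =>
    if h : ∃ p : (Fin k → Fin n) × (Fin k → Fin n), pairExp p.1 p.2 = m then
      R h.choose.1 h.choose.2 else 0) (pairExp i j)
  rw [coe_basisMonomials] at hb
  rw [pairMono_eq_monomial, momentFunctional]
  refine hb.trans ?_
  rw [dif_pos h]
  exact boseSym_apply_eq hR h.choose_spec

lemma momentFunctional_eq_zero (R : TensorMat n k) {p : CPoly n}
    (hp : ∀ i j : Fin k → Fin n, coeff (pairExp i j) p = 0) : momentFunctional R p = 0 := by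
  rw [p.as_sum, map_sum]
  refine Finset.sum_eq_zero fun m hm => ?_
  have hb := (basisMonomials (Fin n ⊕ Fin n) ℂ).constr_basis ℂ (fun m =>
    if h : ∃ p : (Fin k → Fin n) × (Fin k → Fin n), pairExp p.1 p.2 = m then
      R h.choose.1 h.choose.2 else 0) m
  rw [coe_basisMonomials] at hb
  rw [← mul_one (coeff m p), ← smul_eq_mul, ← smul_monomial, map_smul, momentFunctional]
  refine (congrArg _ hb).trans ?_
  rw [dif_neg, smul_zero]
  rintro ⟨⟨i, j⟩, rfl⟩
  exact mem_support_iff.mp hm (hp i j)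

/-! ### Matrices and polynomials -/

/-- The polynomial `⟨X, (xx^*)^{⊗k}⟩`. -/
def matPoly (X : TensorMat n k) : CPoly n :=
  ∑ i, ∑ j, C (starRingEnd ℂ (X i j)) * pairMono i j

lemma matPoly_add (X Y : TensorMat n k) : matPoly (X + Y) = matPoly X + matPoly Y := by
  simp [matPoly, add_mul, Finset.sum_add_distrib]

lemma matPoly_zero : matPoly (0 : TensorMat n k) = 0 := by simp [matPoly]

lemma matPoly_sub (X Y : TensorMat n k) : matPoly (X - Y) = matPoly X - matPoly Y := by
  rw [eq_sub_iff_add_eq, ← matPoly_add, sub_add_cancel]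

lemma matPoly_sum {α : Type*} (s : Finset α) (X : α → TensorMat n k) :
    matPoly (∑ a ∈ s, X a) = ∑ a ∈ s, matPoly (X a) :=
  map_sum (AddMonoidHom.mk' (matPoly (n := n) (k := k)) matPoly_add) X s

lemma polyConj_matPoly {X : TensorMat n k} (hX : X.IsHermitian) :
    polyConj (matPoly X) = matPoly X := by
  simp only [matPoly, polyConj_sum, polyConj_mul, polyConj_C, polyConj_pairMono]
  rw [Finset.sum_comm]
  refine Finset.sum_congr rfl fun i _ => Finset.sum_congr rfl fun j _ => ?_
  rw [← hX.apply i j]; simp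

lemma traceInner_eq_sum {ι : Type*} [Fintype ι] (X Y : Matrix ι ι ℂ) :
    traceInner X Y = (∑ i, ∑ j, starRingEnd ℂ (X i j) * Y i j).re := by
  rw [traceInner, Finset.sum_comm]
  simp [Matrix.trace, Matrix.mul_apply]

/-- The dictionary between matrices and polynomials: pairing with a moment matrix depends on `X`
only through its polynomial. -/
lemma traceInner_eq_re_apply_matPoly {F : CPoly n →ₗ[ℂ] ℂ} {R : TensorMat n k}
    (hF : ∀ i j, F (pairMono i j) = R i j) (X : TensorMat n k) :
    traceInner X R = (F (matPoly X)).re := by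
  simp [traceInner_eq_sum, matPoly, map_sum, ← smul_eq_C_mul, hF]

/-! ### Partial traces -/

/-- Concatenation of sequences as an equivalence. -/
def concatEquiv (n t : ℕ) :
    (Fin n × Fin n) × (Fin t → Fin n) ≃ (Fin (t + 1 + 1) → Fin n) where
  toFun p := concat (t := t + 1) p.1 p.2
  invFun i := ((i 0, i 1), fun r => i r.succ.succ)
  left_inv p := by
    refine Prod.ext (Prod.ext rfl rfl) (funext fun r => ?_)
    simp [concat]
  right_inv i := by
    funext r
    refine Fin.cases ?_ (fun r => Fin.cases ?_ (fun r => ?_) r) r <;> simp [concat]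

@[simp] lemma concatEquiv_zero (p : (Fin n × Fin n) × (Fin t → Fin n)) :
    concatEquiv n t p 0 = p.1.1 := rfl

@[simp] lemma concatEquiv_one (p : (Fin n × Fin n) × (Fin t → Fin n)) :
    concatEquiv n t p 1 = p.1.2 := rfl

@[simp] lemma concatEquiv_succ_succ (p : (Fin n × Fin n) × (Fin t → Fin n)) (r : Fin t) :
    concatEquiv n t p r.succ.succ = p.2 r := by
  simp [concatEquiv, concat]

lemma tensorId_concatEquiv (M : BipMat n) (p q : (Fin n × Fin n) × (Fin t → Fin n)) :
    tensorId (t + 1) M (concatEquiv n t p) (concatEquiv n t q) =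
      M p.1 q.1 * if p.2 = q.2 then 1 else 0 := by
  have h : ∀ r : Fin t, (⟨r.val + 2, by omega⟩ : Fin (t + 1 + 1)) = r.succ.succ := fun r => rfl
  change M (p.1.1, p.1.2) (q.1.1, q.1.2) * ∏ r : Fin t, (1 : Matrix (Fin n) (Fin n) ℂ)
    (concatEquiv n t p r.succ.succ) (concatEquiv n t q r.succ.succ) = _
  simp only [concatEquiv_succ_succ, Matrix.one_apply, Finset.prod_ite_zero, funext_iff]
  simp

lemma tensorId_isHermitian {M : BipMat n} (hM : M.IsHermitian) :
    (tensorId (t + 1) M).IsHermitian := by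
  refine Matrix.IsHermitian.ext fun i j => ?_
  obtain ⟨p, rfl⟩ := (concatEquiv n t).surjective i
  obtain ⟨q, rfl⟩ := (concatEquiv n t).surjective j
  simp only [tensorId_concatEquiv, eq_comm, star_mul', hM.apply]
  split_ifs <;> simp

/-- Stated for a general summand so that it serves both the trace pairing and the polynomial of `M ⊗
I`. -/
lemma sum_tensorId {A : Type*} [AddCommMonoid A] (M : BipMat n)
    {g : ℂ → (Fin (t + 1 + 1) → Fin n) → (Fin (t + 1 + 1) → Fin n) → A}
    (hg : ∀ i j, g 0 i j = 0) :
    ∑ i, ∑ j, g (tensorId (t + 1) M i j) i j =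
      ∑ a, ∑ b, ∑ c, g (M a b) (concatEquiv n t (a, c)) (concatEquiv n t (b, c)) := by
  rw [← (concatEquiv n t).sum_comp, Fintype.sum_prod_type]
  refine Finset.sum_congr rfl fun a _ => ?_
  rw [Finset.sum_comm (s := (Finset.univ : Finset (Fin n × Fin n)))]
  refine Finset.sum_congr rfl fun c _ => ?_
  rw [← (concatEquiv n t).sum_comp, Fintype.sum_prod_type]
  refine Finset.sum_congr rfl fun b _ => ?_
  rw [Finset.sum_eq_single c]
  · simp [tensorId_concatEquiv]
  · intro d _ hd
    rw [tensorId_concatEquiv, if_neg (Ne.symm hd), mul_zero, hg]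
  · simp

lemma traceInner_tensorId (M : BipMat n) (R : TensorMat n (t + 1 + 1)) :
    traceInner M (partialTrace R) = traceInner (tensorId (t + 1) M) R := by
  have h : ∀ (p q : Fin n × Fin n), partialTrace R p q =
      ∑ k : Fin t → Fin n, R (concatEquiv n t (p, k)) (concatEquiv n t (q, k)) := fun _ _ => rfl
  rw [traceInner_eq_sum, traceInner_eq_sum,
    sum_tensorId M (g := fun c i j => starRingEnd ℂ c * R i j) (by simp)]
  simp only [h, Finset.mul_sum]

/-- Each identity register contributes one factor `∑ x_c x̄_c`. -/
lemma matPoly_tensorId (M : BipMat n) :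
    matPoly (tensorId (t + 1) M) = normSqPoly n ^ t * formPoly M := by
  have h : ∀ p q : (Fin n × Fin n) × (Fin t → Fin n),
      (pairMono (concatEquiv n t p) (concatEquiv n t q) : CPoly n) =
        ((var p.1.1 * varBar q.1.1) * (var p.1.2 * varBar q.1.2)) *
          ((∏ r, var (p.2 r)) * ∏ r, varBar (q.2 r)) := fun p q => by
    simp only [pairMono, Fin.prod_univ_succ, concatEquiv_succ_succ, concatEquiv_zero]
    change (var p.1.1 * (var p.1.2 * _)) * (varBar q.1.1 * (varBar q.1.2 * _)) = _
    ring
  have h2 : normSqPoly n ^ t = ∑ c : Fin t → Fin n, ((∏ r, var (c r)) * ∏ r, varBar (c r)) := by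
    rw [normSqPoly, ← Fin.prod_const, Finset.prod_univ_sum, Fintype.piFinset_univ]
    simp only [Finset.prod_mul_distrib]
  rw [matPoly, sum_tensorId M (g := fun c i j => C (starRingEnd ℂ c) * pairMono i j) (by simp),
    formPoly, Finset.mul_sum]
  refine Finset.sum_congr rfl fun a _ => ?_
  rw [Finset.mul_sum]
  refine Finset.sum_congr rfl fun b _ => ?_
  rw [h2, Finset.sum_mul]
  refine Finset.sum_congr rfl fun c _ => ?_
  rw [h]
  ring

/-! ### Partial transposes -/

/-- Replace the entries of `i` at the positions `1, …, s` by those of `j`. -/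
def swapReg (s : ℕ) (i j : Fin (t + 1) → Fin n) : Fin (t + 1) → Fin n :=
  fun r => if 1 ≤ r.val ∧ r.val ≤ s then j r else i r

lemma partialTranspose_apply (s : ℕ) (ρ : TensorMat n (t + 1)) (i j : Fin (t + 1) → Fin n) :
    partialTranspose s ρ i j = ρ (swapReg s i j) (swapReg s j i) := rfl

@[simp] lemma swapReg_swapReg (s : ℕ) (i j : Fin (t + 1) → Fin n) :
    swapReg s (swapReg s i j) (swapReg s j i) = i := by
  funext r
  simp only [swapReg]
  split_ifs <;> rfl

lemma partialTranspose_partialTranspose (s : ℕ) (ρ : TensorMat n (t + 1)) :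
    partialTranspose s (partialTranspose s ρ) = ρ := by
  ext i j
  simp [partialTranspose_apply]

lemma sum_swapReg {A : Type*} [AddCommMonoid A] (s : ℕ)
    (g : (Fin (t + 1) → Fin n) → (Fin (t + 1) → Fin n) → A) :
    ∑ i, ∑ j, g (swapReg s i j) (swapReg s j i) = ∑ i, ∑ j, g i j := by
  let f : (Fin (t + 1) → Fin n) × (Fin (t + 1) → Fin n) →
      (Fin (t + 1) → Fin n) × (Fin (t + 1) → Fin n) :=
    fun p => (swapReg s p.1 p.2, swapReg s p.2 p.1)
  have h : Function.Involutive f := fun p => by simp [f]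
  have h2 := Equiv.sum_comp h.toPerm
    fun p : (Fin (t + 1) → Fin n) × (Fin (t + 1) → Fin n) => g p.1 p.2
  rw [Fintype.sum_prod_type, Fintype.sum_prod_type] at h2
  exact h2

lemma traceInner_partialTranspose (s : ℕ) (X Y : TensorMat n (t + 1)) :
    traceInner (partialTranspose s X) (partialTranspose s Y) = traceInner X Y := by
  rw [traceInner_eq_sum, traceInner_eq_sum,
    ← sum_swapReg s fun i j => starRingEnd ℂ (X i j) * Y i j]
  rfl

lemma partialTranspose_isHermitian (s : ℕ) {X : TensorMat n (t + 1)} (hX : X.IsHermitian) :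
    (partialTranspose s X).IsHermitian :=
  Matrix.IsHermitian.ext fun i j => by simp only [partialTranspose_apply, hX.apply]

lemma traceInner_nonneg_of_posSemidef {ι : Type*} [Fintype ι] {X Y : Matrix ι ι ℂ}
    (hX : X.PosSemidef) (hY : Y.PosSemidef) : 0 ≤ traceInner X Y := by
  classical
  obtain ⟨m, v, rfl⟩ := Matrix.posSemidef_iff_eq_sum_vecMulVec.mp hX
  rw [traceInner, hX.1.eq, Finset.sum_mul, Matrix.trace_sum, Complex.re_sum]
  refine Finset.sum_nonneg fun l _ => ?_
  rw [Matrix.vecMulVec_mul, Matrix.trace_vecMulVec, dotProduct_comm, ← Matrix.dotProduct_mulVec]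
  exact (Complex.le_def.mp (hY.dotProduct_mulVec_nonneg (v l))).1

lemma traceInner_nonneg_of_mem_coneW {s : ℕ} {W R : TensorMat n (t + 1)} (hW : W ∈ coneW n t s)
    (hR : (partialTranspose s R).PosSemidef) : 0 ≤ traceInner W R := by
  rw [← traceInner_partialTranspose s]
  exact traceInner_nonneg_of_posSemidef hW.2 hR

/-! ### Polynomials of bidegree `(t + 1 - s, s)` -/

/-- The monomial `∏ y_r` where `y_r` is `x̄_{i_r}` at the positions `1, …, s` and `x_{i_r}`
elsewhere. -/
def partialMono (s : ℕ) (i : Fin (t + 1) → Fin n) : CPoly n :=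
  ∏ r, if 1 ≤ r.val ∧ r.val ≤ s then varBar (i r) else var (i r)

/-- At a barred position the factor is `x̄_{i_r} x_{j_r}`, with row and column index exchanged. This
is where partial transposition enters. -/
lemma partialMono_mul_polyConj (s : ℕ) (i j : Fin (t + 1) → Fin n) :
    partialMono s i * polyConj (partialMono s j) = pairMono (swapReg s i j) (swapReg s j i) := by
  rw [partialMono, partialMono, polyConj_prod, pairMono, ← Finset.prod_mul_distrib,
    ← Finset.prod_mul_distrib]
  refine Finset.prod_congr rfl fun r _ => ?_
  simp only [swapReg]
  split_ifs
  · rw [polyConj_varBar, mul_comm]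
  · rw [polyConj_var]

/-- The polynomial with coefficient vector `w` with respect to the monomials `partialMono`. -/
def partialForm (n t s : ℕ) : ((Fin (t + 1) → Fin n) → ℂ) →ₗ[ℂ] CPoly n :=
  Fintype.linearCombination ℂ (partialMono s)

lemma partialForm_apply (s : ℕ) (w : (Fin (t + 1) → Fin n) → ℂ) :
    partialForm n t s w = ∑ i, w i • partialMono s i :=
  Fintype.linearCombination_apply ..

lemma partialForm_mul_polyConj (s : ℕ) (w : (Fin (t + 1) → Fin n) → ℂ) :
    partialForm n t s w * polyConj (partialForm n t s w) =
      ∑ i, ∑ j, (w i * starRingEnd ℂ (w j)) • pairMono (swapReg s i j) (swapReg s j i) := by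
  simp only [partialForm_apply, polyConj_sum, polyConj_smul, Finset.sum_mul_sum,
    smul_mul_smul_comm, partialMono_mul_polyConj]

/-- Positive semidefiniteness of the partial transpose is therefore nonnegativity of `F` on the
squares `u ū`. The vector is `star w` because `w`, not its conjugate, sits on the row index. -/
lemma apply_partialForm_mul_polyConj {F : CPoly n →ₗ[ℂ] ℂ} {R : TensorMat n (t + 1)}
    (hF : ∀ i j, F (pairMono i j) = R i j) (s : ℕ) (w : (Fin (t + 1) → Fin n) → ℂ) :
    F (partialForm n t s w * polyConj (partialForm n t s w)) =
      star (star w) ⬝ᵥ Matrix.mulVec (partialTranspose s R) (star w) := by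
  simp only [partialForm_mul_polyConj, map_sum, map_smul, hF, dotProduct, Matrix.mulVec,
    Finset.mul_sum, partialTranspose_apply, star_star, Pi.star_apply, smul_eq_mul]
  refine Finset.sum_congr rfl fun i _ => Finset.sum_congr rfl fun j _ => ?_
  rw [starRingEnd_apply]
  ring

lemma exists_sum_single_eq (k : ℕ) (m : Fin n ⊕ Fin n →₀ ℕ) (hm : Finsupp.degree m = k) :
    ∃ c : Fin k → Fin n ⊕ Fin n, ∑ r, Finsupp.single (c r) 1 = m := by
  induction k generalizing m with
  | zero => exact ⟨Fin.elim0, by simpa using (Finsupp.degree_eq_zero_iff m).mp hm |>.symm⟩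
  | succ k ih =>
    obtain ⟨a, ha⟩ : ∃ a, m a ≠ 0 := by
      by_contra! h
      rw [(Finsupp.ext h : m = 0), map_zero] at hm
      omega
    have hle : Finsupp.single a 1 ≤ m := by
      rw [Finsupp.single_le_iff]; omega
    obtain ⟨m', rfl⟩ := exists_add_of_le hle
    rw [map_add, Finsupp.degree_single] at hm
    obtain ⟨c, rfl⟩ := ih m' (by omega)
    exact ⟨Fin.cons a c, by simp [Fin.sum_univ_succ]⟩

lemma card_bar_positions {s : ℕ} (hs : s ≤ t) :
    Fintype.card {r : Fin (t + 1) // 1 ≤ r.val ∧ r.val ≤ s} = s := by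
  rw [Fintype.card_subtype, Finset.card_filter,
    Fin.sum_univ_eq_sum_range (fun r => if 1 ≤ r ∧ r ≤ s then 1 else 0), ← Finset.card_filter]
  rw [show (Finset.range (t + 1)).filter (fun r => 1 ≤ r ∧ r ≤ s) = Finset.Icc 1 s by
    ext r; simp only [Finset.mem_filter, Finset.mem_range, Finset.mem_Icc]; omega]
  simp

/-- List the variables of `m` and permute the list so that the `s` barred ones occupy positions `1,
…, s`. Position `0` is never barred, whence `s ≤ t`. -/
lemma exists_partialMono_eq {s : ℕ} (hs : s ≤ t) {m : Fin n ⊕ Fin n →₀ ℕ}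
    (hm : Finsupp.degree m = t + 1) (hw : Finsupp.weight barWeight m = s) :
    ∃ i : Fin (t + 1) → Fin n, partialMono s i = monomial m 1 := by
  obtain ⟨c, rfl⟩ := exists_sum_single_eq _ m hm
  have hcard : Fintype.card {r // (c r).isRight = true} = s := by
    rw [← hw, Fintype.card_subtype, Finset.card_filter, map_sum]
    refine Finset.sum_congr rfl fun r _ => ?_
    cases c r <;> simp [barWeight, Finsupp.weight_single]
  obtain ⟨σ, hσ⟩ := exists_perm_of_card_fiber_eq
    (f := fun r : Fin (t + 1) => decide (1 ≤ r.val ∧ r.val ≤ s)) (g := fun r => (c r).isRight) <| by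
      have h1 : Fintype.card {r : Fin (t + 1) // decide (1 ≤ r.val ∧ r.val ≤ s) = true} =
          Fintype.card {r // (c r).isRight = true} := by
        rw [hcard]
        simp only [decide_eq_true_eq]
        exact card_bar_positions hs
      intro b
      cases b
      · have h2 := Fintype.card_compl_eq_card_compl _ _ h1
        simpa only [Bool.not_eq_true] using h2
      · exact h1
  refine ⟨fun r => Sum.elim id id (c (σ r)), ?_⟩
  rw [← Equiv.sum_comp σ, monomial_sum_one, partialMono]
  refine Finset.prod_congr rfl fun r _ => ?_
  have hr := congrFun hσ r
  cases h : c (σ r) with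
  | inl a =>
    rw [h, Sum.isRight_inl, decide_eq_false_iff_not] at hr
    rw [if_neg hr]; rfl
  | inr a =>
    rw [h, Sum.isRight_inr, decide_eq_true_eq] at hr
    rw [if_pos hr]; rfl

lemma exists_partialForm_eq {s : ℕ} (hs : s ≤ t) {p : CPoly n}
    (hp : ∀ m, coeff m p ≠ 0 → Finsupp.degree m = t + 1 ∧ Finsupp.weight barWeight m = s) :
    ∃ w, partialForm n t s w = p := by
  change p ∈ LinearMap.range (partialForm n t s)
  rw [p.as_sum]
  refine Submodule.sum_mem _ fun m hm => ?_
  obtain ⟨h1, h2⟩ := hp m (mem_support_iff.mp hm)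
  obtain ⟨i, hi⟩ := exists_partialMono_eq hs h1 h2
  rw [← mul_one (coeff m p), ← smul_eq_mul, ← smul_monomial, ← hi]
  refine Submodule.smul_mem _ _ ⟨Pi.single i 1, ?_⟩
  simp [partialForm, Fintype.linearCombination_apply_single]

/-! ### Sums of squares and moment functionals -/

lemma weight_barWeight_mapDomain_swap (m : Fin n ⊕ Fin n →₀ ℕ) :
    Finsupp.weight barWeight (m.mapDomain Sum.swap) + Finsupp.weight barWeight m =
      Finsupp.degree m := by
  induction m using Finsupp.induction_linear with
  | zero => simp
  | add f g hf hg => simp only [Finsupp.mapDomain_add, map_add, ← hf, ← hg]; ring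
  | single a b =>
    rw [Finsupp.mapDomain_single]
    cases a <;> simp [Finsupp.weight_single, barWeight, Finsupp.degree_single]

lemma polyConj_homogeneousComponent (d : ℕ) {p : CPoly n} (hp : polyConj p = p) :
    polyConj (homogeneousComponent d p) = homogeneousComponent d p := by
  ext m
  have h := coeff_polyConj p m
  rw [hp] at h
  rw [coeff_polyConj, coeff_homogeneousComponent, coeff_homogeneousComponent,
    Finsupp.degree_mapDomain, apply_ite (starRingEnd ℂ), map_zero, h]

lemma polyConj_weightedHomogeneousComponent {d s : ℕ} (hs : s ≤ d) {p : CPoly n}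
    (hd : p.IsHomogeneous d) (hp : polyConj p = p) :
    polyConj (weightedHomogeneousComponent barWeight s p) =
      weightedHomogeneousComponent barWeight (d - s) p := by
  ext m
  have h := coeff_polyConj p m
  rw [hp] at h
  rw [coeff_polyConj, coeff_weightedHomogeneousComponent, coeff_weightedHomogeneousComponent,
    apply_ite (starRingEnd ℂ), map_zero, ← h]
  have hw := weight_barWeight_mapDomain_swap m
  by_cases hm : Finsupp.degree m = d
  · congr 1
    apply propext
    omega
  · rw [hd.coeff_eq_zero hm, ite_self, ite_self]

/-- If a sum of squares of Hermitian polynomials is homogeneous of degree `2 d`, then the summands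
have no terms of degree less than `d`. -/
lemma mem_pow_idealOfVars_of_sum_sq {α : Type*} [Fintype α] {q : α → CPoly n} {d : ℕ}
    (hq : ∀ l, polyConj (q l) = q l) (h : (∑ l, q l ^ 2).IsHomogeneous (2 * d)) :
    ∀ k ≤ d, ∀ l, q l ∈ idealOfVars (Fin n ⊕ Fin n) ℂ ^ k := by
  intro k
  induction k with
  | zero => simp
  | succ k ih =>
    intro hk
    have ih := ih (by omega)
    have hr : ∀ l, q l - homogeneousComponent k (q l) ∈
        idealOfVars (Fin n ⊕ Fin n) ℂ ^ (k + 1) := fun l => by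
      rw [mem_pow_idealOfVars_iff']
      intro m hm
      rw [coeff_sub, coeff_homogeneousComponent]
      split_ifs with hmk
      · simp
      · rw [sub_zero]
        exact (mem_pow_idealOfVars_iff' k _).mp (ih l) m (by omega)
    have hh : ∀ l, homogeneousComponent k (q l) ∈ idealOfVars (Fin n ⊕ Fin n) ℂ ^ k := fun l => by
      rw [mem_pow_idealOfVars_iff']
      intro m hm
      rw [coeff_homogeneousComponent, if_neg hm.ne]
    have hsum : ∑ l, q l ^ 2 - ∑ l, homogeneousComponent k (q l) ^ 2 ∈
        idealOfVars (Fin n ⊕ Fin n) ℂ ^ (2 * k + 1) := by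
      rw [← Finset.sum_sub_distrib]
      refine Submodule.sum_mem _ fun l _ => ?_
      rw [sq_sub_sq, show 2 * k + 1 = k + (k + 1) by ring, pow_add]
      exact Ideal.mul_mem_mul (add_mem (ih l) (hh l)) (hr l)
    -- The degree `2k` part of the sum of squares is the sum of the squares of the degree `k` parts.
    -- It vanishes as `k < d`, so formal reality kills each degree `k` part.
    have hzero : ∑ l, homogeneousComponent k (q l) ^ 2 = 0 := by
      ext m
      rw [coeff_zero]
      have hhom : (∑ l, homogeneousComponent k (q l) ^ 2).IsHomogeneous (k * 2) :=
        IsHomogeneous.sum _ _ _ fun l _ => (homogeneousComponent_isHomogeneous k (q l)).pow 2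
      by_cases hm : Finsupp.degree m = k * 2
      · have h2 := (mem_pow_idealOfVars_iff' _ _).mp hsum m (by omega)
        rw [coeff_sub, h.coeff_eq_zero (by omega), zero_sub, neg_eq_zero] at h2
        exact h2
      · exact hhom.coeff_eq_zero hm
    intro l
    have h0 := eq_zero_of_sum_sq_eq_zero
      (fun l _ => polyConj_homogeneousComponent k (hq l)) hzero l (Finset.mem_univ l)
    simpa [h0] using hr l

lemma sum_weightedHomogeneousComponent_barWeight {d : ℕ} {p : CPoly n} (hp : p.IsHomogeneous d) :
    ∑ s ∈ Finset.range (d + 1), weightedHomogeneousComponent barWeight s p = p := by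
  ext m
  simp only [coeff_sum, coeff_weightedHomogeneousComponent]
  rw [Finset.sum_ite_eq]
  split_ifs with hm
  · rfl
  · by_contra h
    have h1 : Finsupp.degree m = d := by
      by_contra h1
      exact h (hp.coeff_eq_zero h1).symm
    have := weight_barWeight_mapDomain_swap m
    exact hm (Finset.mem_range.mpr (by omega))

lemma momentFunctional_partialForm_nonneg {R : TensorMat n (t + 1)} (hR : R ∈ boseSym n (t + 1))
    {s : ℕ} (hs : (partialTranspose s R).PosSemidef) (w : (Fin (t + 1) → Fin n) → ℂ) :
    0 ≤ momentFunctional R (partialForm n t s w * polyConj (partialForm n t s w)) := by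
  rw [apply_partialForm_mul_polyConj (momentFunctional_pairMono hR)]
  exact hs.dotProduct_mulVec_nonneg _

/-- Split `h` by the number of barred variables. The functional only sees products `c s * c (t + 1 -
s)`, and since `h` is Hermitian the two factors are conjugate. The hypothesis `1 ≤ t` ensures `(t +
1) / 2 ≤ t`. -/
lemma momentFunctional_sq_nonneg_of_isHomogeneous (ht : 1 ≤ t) {R : TensorMat n (t + 1)}
    (hR : R ∈ boseSym n (t + 1))
    (hpos : ∀ s ≤ (t + 1) / 2, (partialTranspose s R).PosSemidef) {h : CPoly n}
    (hh : h.IsHomogeneous (t + 1)) (hc : polyConj h = h) : 0 ≤ momentFunctional R (h ^ 2) := by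
  set c : ℕ → CPoly n := fun s => weightedHomogeneousComponent barWeight s h with hcdef
  have hlow : ∀ s ≤ (t + 1) / 2, 0 ≤ momentFunctional R (c s * polyConj (c s)) := fun s hs => by
    obtain ⟨w, hw⟩ := exists_partialForm_eq (t := t) (s := s) (p := c s) (by omega) fun m hm => by
      rw [hcdef] at hm
      simp only [coeff_weightedHomogeneousComponent] at hm
      split_ifs at hm with hms
      · exact ⟨by by_contra h1; exact hm (hh.coeff_eq_zero h1), hms⟩
      · exact absurd rfl hm
    rw [← hw]
    exact momentFunctional_partialForm_nonneg hR (hpos s hs) w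
  have hconj : ∀ s ≤ t + 1, polyConj (c s) = c (t + 1 - s) := fun s hs =>
    polyConj_weightedHomogeneousComponent hs hh hc
  have hvanish : ∀ s s', s + s' ≠ t + 1 → momentFunctional R (c s * c s') = 0 := fun s s' hss => by
    refine momentFunctional_eq_zero R fun i j => ?_
    refine IsWeightedHomogeneous.coeff_eq_zero
      ((weightedHomogeneousComponent_isWeightedHomogeneous (w := barWeight) s h).mul
        (weightedHomogeneousComponent_isWeightedHomogeneous s' h)) _ ?_
    rw [weight_barWeight_pairExp]
    exact hss.symm
  rw [← sum_weightedHomogeneousComponent_barWeight hh, sq, Finset.sum_mul_sum, map_sum]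
  refine Finset.sum_nonneg fun s hs => ?_
  rw [map_sum]
  refine Finset.sum_nonneg fun s' hs' => ?_
  rw [Finset.mem_range] at hs hs'
  by_cases hss : s + s' = t + 1
  -- One of `s`, `s'` is at most `(t + 1) / 2`, and the product is the Hermitian square of the
  -- corresponding component.
  · rcases le_or_gt s ((t + 1) / 2) with hle | hlt
    · have := hlow s hle
      rwa [hconj s (by omega), show t + 1 - s = s' by omega] at this
    · have := hlow s' (by omega)
      rwa [hconj s' (by omega), show t + 1 - s' = s by omega, mul_comm] at this
  · exact (hvanish s s' hss).ge

/-- Each `q l` starts in degree `t + 1`. Replacing it by that lowest component changes its square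
only in degrees above `2 (t + 1)`, where the functional vanishes. -/
lemma momentFunctional_sum_sq_nonneg (ht : 1 ≤ t) {R : TensorMat n (t + 1)}
    (hR : R ∈ boseSym n (t + 1))
    (hpos : ∀ s ≤ (t + 1) / 2, (partialTranspose s R).PosSemidef)
    {α : Type*} [Fintype α] {q : α → CPoly n} (hq : ∀ l, polyConj (q l) = q l)
    (h : (∑ l, q l ^ 2).IsHomogeneous (2 * (t + 1))) :
    0 ≤ momentFunctional R (∑ l, q l ^ 2) := by
  rw [map_sum]
  refine Finset.sum_nonneg fun l _ => ?_
  have hl := mem_pow_idealOfVars_of_sum_sq hq h (t + 1) le_rfl l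
  have hhom := homogeneousComponent_isHomogeneous (t + 1) (q l)
  set g := homogeneousComponent (t + 1) (q l) with hg
  have hgl : g ∈ idealOfVars (Fin n ⊕ Fin n) ℂ ^ (t + 1) := by
    rw [mem_pow_idealOfVars_iff']
    intro m hm
    exact hhom.coeff_eq_zero hm.ne
  have hr : q l - g ∈ idealOfVars (Fin n ⊕ Fin n) ℂ ^ (t + 1 + 1) := by
    rw [mem_pow_idealOfVars_iff']
    intro m hm
    rw [coeff_sub, hg, coeff_homogeneousComponent]
    split_ifs with hmk
    · simp
    · rw [sub_zero]
      exact (mem_pow_idealOfVars_iff' _ _).mp hl m (by omega)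
  have hdiff : q l ^ 2 - g ^ 2 ∈ idealOfVars (Fin n ⊕ Fin n) ℂ ^ (2 * (t + 1) + 1) := by
    rw [sq_sub_sq, show 2 * (t + 1) + 1 = (t + 1) + (t + 1 + 1) by ring, pow_add]
    exact Ideal.mul_mem_mul (add_mem hl hgl) hr
  have heq : momentFunctional R (q l ^ 2) = momentFunctional R (g ^ 2) := by
    rw [← sub_eq_zero, ← map_sub]
    refine momentFunctional_eq_zero R fun i j => ?_
    exact (mem_pow_idealOfVars_iff' _ _).mp hdiff _ (by rw [degree_pairExp]; omega)
  rw [heq]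
  exact momentFunctional_sq_nonneg_of_isHomogeneous ht hR hpos hhom
    (polyConj_homogeneousComponent _ (hq l))

lemma matPoly_isHomogeneous (X : TensorMat n k) : (matPoly X).IsHomogeneous (2 * k) := by
  refine IsHomogeneous.sum _ _ _ fun i _ => IsHomogeneous.sum _ _ _ fun j _ => ?_
  rw [pairMono_eq_monomial, C_mul_monomial]
  exact isHomogeneous_monomial _ (degree_pairExp i j)

/-! ### Hermitian functionals and feasible points of the relaxation -/

/-- The moment matrix of a linear functional. -/
def momentMatrix (k : ℕ) (F : CPoly n →ₗ[ℂ] ℂ) : TensorMat n k :=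
  Matrix.of fun i j => F (pairMono i j)

lemma momentMatrix_mem_boseSym {F : CPoly n →ₗ[ℂ] ℂ}
    (hF : ∀ p, F (polyConj p) = starRingEnd ℂ (F p)) : momentMatrix k F ∈ boseSym n k := by
  refine ⟨Matrix.IsHermitian.ext fun i j => ?_, fun σ i j => ?_⟩
  · change starRingEnd ℂ (F (pairMono j i)) = F (pairMono i j)
    rw [← hF, polyConj_pairMono]
  · change F (pairMono _ _) = F (pairMono i j)
    rw [pairMono, pairMono, Equiv.prod_comp σ fun r => varBar (j r)]

lemma partialTrace_isHermitian {R : TensorMat n (t + 1)} (hR : R.IsHermitian) :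
    (partialTrace R).IsHermitian :=
  Matrix.IsHermitian.ext fun i j => by simp [partialTrace, ← hR.apply (concat i _)]

lemma partialTrace_momentMatrix_mem_symDPS {F : CPoly n →ₗ[ℂ] ℂ}
    (hF : ∀ p, F (polyConj p) = starRingEnd ℂ (F p))
    (hpos : ∀ s ≤ (t + 1) / 2, ∀ w,
      0 ≤ F (partialForm n t s w * polyConj (partialForm n t s w))) :
    partialTrace (momentMatrix (t + 1) F) ∈ symDPS n t := by
  have hR : momentMatrix (t + 1) F ∈ boseSym n (t + 1) := momentMatrix_mem_boseSym hF
  refine ⟨partialTrace_isHermitian hR.1, _, hR, fun s hs => ?_, rfl⟩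
  refine Matrix.PosSemidef.of_dotProduct_mulVec_nonneg (partialTranspose_isHermitian s hR.1)
    fun x => ?_
  have h := hpos s hs (star x)
  rwa [apply_partialForm_mul_polyConj (R := momentMatrix (t + 1) F) fun _ _ => rfl,
    star_star x] at h

/-! ### The cone of Hermitian squares -/

/-- The cone generated by the polynomials `u ū` with `u` of bidegree `(t + 1 - s, s)` and
`s ≤ (t + 1) / 2`. -/
def squareCone (n t : ℕ) : AddSubmonoid (CPoly n) :=
  AddSubmonoid.closure {p | ∃ s ≤ (t + 1) / 2, ∃ w,
    p = partialForm n t s w * polyConj (partialForm n t s w)}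

lemma partialForm_mem_squareCone {s : ℕ} (hs : s ≤ (t + 1) / 2) (w) :
    partialForm n t s w * polyConj (partialForm n t s w) ∈ squareCone n t :=
  AddSubmonoid.subset_closure ⟨s, hs, w, rfl⟩

lemma real_smul_eq (c : ℝ) (p : CPoly n) : c • p = (c : ℂ) • p := by
  ext m
  simp [coeff_smul]

lemma partialForm_real_smul (s : ℕ) (c : ℝ) (w : (Fin (t + 1) → Fin n) → ℂ) :
    partialForm n t s ((c : ℂ) • w) * polyConj (partialForm n t s ((c : ℂ) • w)) =
      (c ^ 2) • (partialForm n t s w * polyConj (partialForm n t s w)) := by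
  rw [map_smul, polyConj_smul, Complex.conj_ofReal, smul_mul_smul_comm, real_smul_eq]
  push_cast
  rw [sq]

lemma smul_mem_squareCone {c : ℝ} (hc : 0 ≤ c) {p : CPoly n} (hp : p ∈ squareCone n t) :
    c • p ∈ squareCone n t := by
  induction hp using AddSubmonoid.closure_induction with
  | mem p hp =>
    obtain ⟨s, hs, w, rfl⟩ := hp
    rw [← Real.sq_sqrt hc, ← partialForm_real_smul]
    exact partialForm_mem_squareCone hs _
  | zero => rw [smul_zero]; exact zero_mem _
  | add p q _ _ hp hq => rw [smul_add]; exact add_mem hp hq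

lemma convex_squareCone : Convex ℝ (squareCone n t : Set (CPoly n)) :=
  fun _ hp _ hq _ _ ha hb _ => add_mem (smul_mem_squareCone ha hp) (smul_mem_squareCone hb hq)

/-- The polynomials of bidegree `(k, k)`. -/
def bihom (n k : ℕ) : Submodule ℂ (CPoly n) :=
  Submodule.span ℂ (Set.range fun p : (Fin k → Fin n) × (Fin k → Fin n) => pairMono p.1 p.2)

lemma pairMono_mem_bihom (i j : Fin k → Fin n) : pairMono i j ∈ bihom n k :=
  Submodule.subset_span ⟨(i, j), rfl⟩

lemma matPoly_mem_bihom (X : TensorMat n k) : matPoly X ∈ bihom n k := by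
  refine Submodule.sum_mem _ fun i _ => Submodule.sum_mem _ fun j _ => ?_
  rw [← smul_eq_C_mul]
  exact Submodule.smul_mem _ _ (pairMono_mem_bihom i j)

lemma partialForm_mem_bihom (s : ℕ) (w) :
    partialForm n t s w * polyConj (partialForm n t s w) ∈ bihom n (t + 1) := by
  rw [partialForm_mul_polyConj]
  exact Submodule.sum_mem _ fun i _ => Submodule.sum_mem _ fun j _ =>
    Submodule.smul_mem _ _ (pairMono_mem_bihom _ _)

/-- The coefficients of the monomials of bidegree `(k, k)`. -/
def bihomCoeff (n k : ℕ) : CPoly n →ₗ[ℂ] ((Fin k → Fin n) → (Fin k → Fin n) → ℂ) :=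
  LinearMap.pi fun i => LinearMap.pi fun j => lcoeff ℂ (pairExp i j)

lemma bihomCoeff_apply (p : CPoly n) (i j : Fin k → Fin n) :
    bihomCoeff n k p i j = coeff (pairExp i j) p := rfl

/-- Injectivity on `bihom n k` lets the convexity argument run in a finite-dimensional normed space
of coefficients. -/
lemma eq_zero_of_bihomCoeff_eq_zero {p : CPoly n} (hp : p ∈ bihom n k)
    (h : bihomCoeff n k p = 0) : p = 0 := by
  have hsupp : ∀ m, (∀ i j : Fin k → Fin n, pairExp i j ≠ m) → coeff m p = 0 := fun m hm => by
    clear h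
    induction hp using Submodule.span_induction with
    | mem q hq =>
      obtain ⟨⟨i, j⟩, rfl⟩ := hq
      beta_reduce
      rw [pairMono_eq_monomial, coeff_monomial, if_neg (hm i j)]
    | zero => simp
    | add p q _ _ hp hq => rw [coeff_add, hp, hq, add_zero]
    | smul c p _ hp => rw [coeff_smul, hp, smul_zero]
  ext m
  by_cases hm : ∀ i j : Fin k → Fin n, pairExp i j ≠ m
  · exact hsupp m hm
  · push Not at hm
    obtain ⟨i, j, rfl⟩ := hm
    exact congrFun (congrFun h i) j

/-- A set of normalized generators of `squareCone` whose coefficient vectors form a compact set. -/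
def squareBase (n t : ℕ) : Set (CPoly n) :=
  {p | ∃ s ≤ (t + 1) / 2, ∃ w, ‖w‖ = 1 ∧
    w ∈ Classical.choose (Submodule.exists_isCompl (LinearMap.ker (partialForm n t s))) ∧
    p = partialForm n t s w * polyConj (partialForm n t s w)}

/-- Different index sequences can give the same monomial, so `partialForm` has a kernel. Discarding
the kernel part of `w` loses nothing, and a unit vector in the complement gives a nonzero square. -/
lemma exists_squareBase_smul {s : ℕ} (hs : s ≤ (t + 1) / 2) (w : (Fin (t + 1) → Fin n) → ℂ) :
    partialForm n t s w * polyConj (partialForm n t s w) = 0 ∨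
      ∃ c : ℝ, 0 ≤ c ∧ ∃ p ∈ squareBase n t,
        partialForm n t s w * polyConj (partialForm n t s w) = c • p := by
  have hQ := Classical.choose_spec
    (Submodule.exists_isCompl (LinearMap.ker (partialForm n t s)))
  set Q := Classical.choose (Submodule.exists_isCompl (LinearMap.ker (partialForm n t s)))
  obtain ⟨a, ha, v, hv, rfl⟩ := Submodule.mem_sup.mp (hQ.sup_eq_top ▸ Submodule.mem_top : w ∈ _ ⊔ _)
  rw [map_add, LinearMap.mem_ker.mp ha, zero_add]
  rcases eq_or_ne v 0 with rfl | hv0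
  · left; simp
  · right
    have hn : ‖v‖ ≠ 0 := norm_ne_zero_iff.mpr hv0
    refine ⟨‖v‖ ^ 2, by positivity, _,
      ⟨s, hs, ((‖v‖⁻¹ : ℝ) : ℂ) • v, ?_, Q.smul_mem _ hv, rfl⟩, ?_⟩
    · rw [norm_smul, Complex.norm_real, norm_inv, norm_norm, inv_mul_cancel₀ hn]
    · rw [partialForm_real_smul, smul_smul, ← mul_pow, mul_inv_cancel₀ hn, one_pow, one_smul]

lemma isCompact_bihomCoeff_squareBase :
    IsCompact (bihomCoeff n (t + 1) '' squareBase n t) := by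
  let Q : ℕ → Submodule ℂ ((Fin (t + 1) → Fin n) → ℂ) := fun s =>
    Classical.choose (Submodule.exists_isCompl (LinearMap.ker (partialForm n t s)))
  let g : ℕ → ((Fin (t + 1) → Fin n) → ℂ) → ((Fin (t + 1) → Fin n) → (Fin (t + 1) → Fin n) → ℂ) :=
    fun s w => bihomCoeff n (t + 1) (partialForm n t s w * polyConj (partialForm n t s w))
  have hg : ∀ s, Continuous (g s) := fun s => by
    refine continuous_pi fun i => continuous_pi fun j => ?_
    simp only [g, bihomCoeff_apply, partialForm_mul_polyConj, coeff_sum, coeff_smul]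
    fun_prop
  have hc : IsCompact (⋃ s ∈ Finset.range ((t + 1) / 2 + 1),
      g s '' (Metric.sphere 0 1 ∩ (Q s : Set ((Fin (t + 1) → Fin n) → ℂ)))) :=
    Finset.isCompact_biUnion _ fun s _ =>
      ((isCompact_sphere _ _).inter_right (Submodule.closed_of_finiteDimensional _)).image (hg s)
  convert hc using 1
  ext y
  simp only [Set.mem_iUnion, Finset.mem_range, Set.mem_image, Set.mem_inter_iff,
    mem_sphere_zero_iff_norm, SetLike.mem_coe, exists_prop]
  constructor
  · rintro ⟨_, ⟨s, hs, w, hw, hwQ, rfl⟩, rfl⟩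
    exact ⟨s, by omega, w, ⟨hw, hwQ⟩, rfl⟩
  · rintro ⟨s, hs, w, ⟨hw, hwQ⟩, rfl⟩
    exact ⟨_, ⟨s, by omega, w, hw, hwQ, rfl⟩, rfl⟩

lemma squareBase_subset_squareCone : squareBase n t ⊆ squareCone n t := by
  rintro _ ⟨s, hs, w, -, -, rfl⟩
  exact partialForm_mem_squareCone hs w

lemma convexHull_squareBase_subset_squareCone :
    convexHull ℝ (squareBase n t) ⊆ squareCone n t :=
  convexHull_min squareBase_subset_squareCone convex_squareCone

lemma convexHull_squareBase_subset_bihom :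
    convexHull ℝ (squareBase n t) ⊆ bihom n (t + 1) := by
  refine convexHull_min ?_ ((bihom n (t + 1)).restrictScalars ℝ).convex
  rintro _ ⟨s, hs, w, -, -, rfl⟩
  exact partialForm_mem_bihom s w

/-- Having nonnegative real part at every point and positive real part at some point is a convex
condition. It holds on the base and fails for zero. -/
lemma zero_notMem_convexHull_squareBase : (0 : CPoly n) ∉ convexHull ℝ (squareBase n t) := by
  have hconv : Convex ℝ {p : CPoly n | (∀ z, 0 ≤ (evalAt z p).re) ∧ ∃ z, 0 < (evalAt z p).re} := by
    rintro p ⟨hp, zp, hzp⟩ q ⟨hq, zq, hzq⟩ a b ha hb hab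
    have he : ∀ z, (evalAt z (a • p + b • q)).re =
        a * (evalAt z p).re + b * (evalAt z q).re := fun z => by
      rw [real_smul_eq, real_smul_eq, map_add, evalAt_smul, evalAt_smul, Complex.add_re,
        Complex.re_ofReal_mul, Complex.re_ofReal_mul]
    refine ⟨fun z => ?_, ?_⟩
    · rw [he]
      exact add_nonneg (mul_nonneg ha (hp z)) (mul_nonneg hb (hq z))
    · rcases ha.eq_or_lt with rfl | ha'
      · refine ⟨zq, ?_⟩
        rw [he, show b = 1 by linarith]
        simpa using hzq
      · refine ⟨zp, ?_⟩
        rw [he]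
        exact add_pos_of_pos_of_nonneg (mul_pos ha' hzp) (mul_nonneg hb (hq zp))
  intro h0
  have hsub : squareBase n t ⊆
      {p : CPoly n | (∀ z, 0 ≤ (evalAt z p).re) ∧ ∃ z, 0 < (evalAt z p).re} := by
    rintro _ ⟨s, hs, w, hw, hwQ, rfl⟩
    have hne : partialForm n t s w ≠ 0 := fun h => by
      have hQ := Classical.choose_spec
        (Submodule.exists_isCompl (LinearMap.ker (partialForm n t s)))
      have := Submodule.disjoint_def.mp hQ.disjoint w (LinearMap.mem_ker.mpr h) hwQ
      simp [this] at hw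
    obtain ⟨z, hz⟩ : ∃ z, evalAt z (partialForm n t s w) ≠ 0 := by
      by_contra! h
      exact hne (eq_zero_of_evalAt_eq_zero h)
    refine ⟨fun z => ?_, z, ?_⟩
    · rw [evalAt_mul_polyConj, Complex.ofReal_re]
      exact Complex.normSq_nonneg _
    · rw [evalAt_mul_polyConj, Complex.ofReal_re]
      exact Complex.normSq_pos.mpr hz
  obtain ⟨-, z, hz⟩ := convexHull_min hsub hconv h0
  simp at hz

/-- The Hermitian complex-linear functional whose real part agrees on Hermitian polynomials with a
given real-linear functional. -/
lemma exists_hermitian_functional (g : CPoly n →ₗ[ℝ] ℝ) :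
    ∃ F : CPoly n →ₗ[ℂ] ℂ, (∀ p, F (polyConj p) = starRingEnd ℂ (F p)) ∧
      ∀ p, polyConj p = p → F p = g p := by
  let F₀ : CPoly n →ₗ[ℂ] ℂ := Module.Dual.extendRCLike (𝕜 := ℂ) g
  have hre : ∀ p, (F₀ p).re = g p := fun p => Module.Dual.re_extendRCLike_apply (𝕜 := ℂ) g p
  -- Average the complexification with its conjugate under `polyConj`; on Hermitian polynomials this
  -- leaves the real part.
  let F : CPoly n →ₗ[ℂ] ℂ :=
    { toFun := fun p => (F₀ p + starRingEnd ℂ (F₀ (polyConj p))) / 2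
      map_add' := fun p q => by
        simp only [polyConj_add, map_add]
        ring
      map_smul' := fun c p => by
        simp only [polyConj_smul, map_smul, smul_eq_mul, map_mul, Complex.conj_conj,
          RingHom.id_apply]
        ring }
  have hF : ∀ p, F p = (F₀ p + starRingEnd ℂ (F₀ (polyConj p))) / 2 := fun _ => rfl
  refine ⟨F, fun p => ?_, fun p hp => ?_⟩
  · rw [hF, hF, polyConj_polyConj]
    simp only [map_div₀, map_add, Complex.conj_conj, map_ofNat]
    rw [add_comm]
  · rw [hF, hp, Complex.add_conj, hre]
    push_cast
    ring

lemma polyConj_mul_polyConj_self (u : CPoly n) : polyConj (u * polyConj u) = u * polyConj u := by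
  rw [polyConj_mul, polyConj_polyConj, mul_comm]

/-- Duality: `squareCone` contains every Hermitian polynomial of bidegree `(t + 1, t + 1)` on
which all Hermitian functionals nonnegative on the cone are nonnegative. -/
lemma mem_squareCone_of_dual {p : CPoly n} (hp : p ∈ bihom n (t + 1)) (hpc : polyConj p = p)
    (h : ∀ F : CPoly n →ₗ[ℂ] ℂ, (∀ q, F (polyConj q) = starRingEnd ℂ (F q)) →
      (∀ s ≤ (t + 1) / 2, ∀ w, 0 ≤ F (partialForm n t s w * polyConj (partialForm n t s w))) →
      0 ≤ (F p).re) : p ∈ squareCone n t := by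
  by_contra hnot
  let Ψ : CPoly n →ₗ[ℝ] ((Fin (t + 1) → Fin n) → (Fin (t + 1) → Fin n) → ℂ) :=
    (bihomCoeff n (t + 1)).restrictScalars ℝ
  have hinj : ∀ q ∈ bihom n (t + 1), Ψ q = 0 → q = 0 := fun q hq hq0 =>
    eq_zero_of_bihomCoeff_eq_zero hq hq0
  have himage : convexHull ℝ (Ψ '' squareBase n t) = Ψ '' convexHull ℝ (squareBase n t) :=
    (Ψ.image_convexHull _).symm
  obtain ⟨f, hf, hfp⟩ := exists_dual_separating (s := Ψ '' squareBase n t) (x := Ψ p)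
    isCompact_bihomCoeff_squareBase
    (by
      rw [himage]
      rintro ⟨q, hq, hq0⟩
      rw [hinj q (convexHull_squareBase_subset_bihom hq) hq0] at hq
      exact zero_notMem_convexHull_squareBase hq)
    (fun h0 => hnot (hinj p hp h0 ▸ zero_mem _))
    (by
      rw [himage]
      rintro c hc _ ⟨q, hq, rfl⟩ heq
      have hcq : c • q ∈ bihom n (t + 1) :=
        ((bihom n (t + 1)).restrictScalars ℝ).smul_mem c (convexHull_squareBase_subset_bihom hq)
      have : p - c • q = 0 := hinj _ (sub_mem hp hcq) (by rw [map_sub, map_smul, heq, sub_self])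
      rw [sub_eq_zero] at this
      exact hnot (this ▸ smul_mem_squareCone hc (convexHull_squareBase_subset_squareCone hq)))
  -- Pulled back to polynomials, the separating functional is an admissible `F` that is negative at
  -- `p`.
  obtain ⟨F, hF, hFre⟩ := exists_hermitian_functional (f.toLinearMap.comp Ψ)
  have hFp := h F hF fun s hs w => by
    rw [hFre _ (polyConj_mul_polyConj_self _)]
    rw [Complex.zero_le_real]
    rcases exists_squareBase_smul hs w with h0 | ⟨c, hc, q, hq, h0⟩
    · rw [h0, map_zero]
    · rw [h0, map_smul, smul_eq_mul]
      exact mul_nonneg hc (hf _ ⟨q, hq, rfl⟩)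
  rw [hFre p hpc, Complex.ofReal_re] at hFp
  exact absurd hFp (not_le.mpr hfp)

/-! ### Elements of the cone of Hermitian squares -/

lemma IsRSOS.add {p q : CPoly n} (hp : IsRSOS p) (hq : IsRSOS q) : IsRSOS (p + q) := by
  obtain ⟨m, a, ha, rfl⟩ := hp
  obtain ⟨l, b, hb, rfl⟩ := hq
  refine ⟨m + l, Fin.append a b, fun k => ?_, ?_⟩
  · refine Fin.addCases (fun i => ?_) (fun i => ?_) k
    · rw [Fin.append_left, ha]
    · rw [Fin.append_right, hb]
  · simp [Fin.sum_univ_add]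

/-- This is `|u|² = (Re u)² + (Im u)²`; the second entry is `-Im u`. -/
lemma isRSOS_mul_polyConj (u : CPoly n) : IsRSOS (u * polyConj u) := by
  refine ⟨2, ![C (1 / 2) * (u + polyConj u), C (Complex.I / 2) * (u - polyConj u)], ?_, ?_⟩
  · have h2 : starRingEnd ℂ 2 = 2 := map_ofNat _ 2
    intro l
    fin_cases l
    · simp [polyConj_mul, polyConj_add, add_comm, h2]
    · have hsub : polyConj (u - polyConj u) = -(u - polyConj u) := by
        rw [← polyConjHom_apply, map_sub, polyConjHom_apply, polyConjHom_apply, polyConj_polyConj,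
          neg_sub]
      simp only [Fin.mk_one, Matrix.cons_val_one, Matrix.cons_val_fin_one, polyConj_mul, hsub,
        polyConj_C, map_div₀, Complex.conj_I, h2, neg_div, map_neg, neg_mul_neg]
  · rw [Fin.sum_univ_two]
    simp only [Matrix.cons_val_zero, Matrix.cons_val_one, mul_pow, ← map_pow, div_pow,
      Complex.I_sq]
    rw [neg_div, map_neg, one_pow, neg_mul, ← sub_eq_add_neg, ← mul_sub,
      show (u + polyConj u) ^ 2 - (u - polyConj u) ^ 2 = C 4 * (u * polyConj u) by
        rw [show (4 : ℂ) = ((4 : ℕ) : ℂ) by norm_num, map_natCast]; push_cast; ring,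
      ← mul_assoc, ← map_mul]
    norm_num

lemma isRSOS_of_mem_squareCone {p : CPoly n} (hp : p ∈ squareCone n t) : IsRSOS p := by
  induction hp using AddSubmonoid.closure_induction with
  | mem p hp =>
    obtain ⟨s, -, w, rfl⟩ := hp
    exact isRSOS_mul_polyConj _
  | zero => exact ⟨0, Fin.elim0, fun l => l.elim0, by simp⟩
  | add p q _ _ hp hq => exact hp.add hq

lemma partialTranspose_add (s : ℕ) (X Y : TensorMat n (t + 1)) :
    partialTranspose s (X + Y) = partialTranspose s X + partialTranspose s Y := rfl

lemma zero_mem_coneW (s : ℕ) : (0 : TensorMat n (t + 1)) ∈ coneW n t s :=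
  ⟨Matrix.isHermitian_zero, Matrix.PosSemidef.zero⟩

lemma add_mem_coneW {s : ℕ} {X Y : TensorMat n (t + 1)} (hX : X ∈ coneW n t s)
    (hY : Y ∈ coneW n t s) : X + Y ∈ coneW n t s :=
  ⟨hX.1.add hY.1, by rw [partialTranspose_add]; exact hX.2.add hY.2⟩

/-- Take the partial transpose of a rank-one projector-like matrix: transposing again restores
positivity, and its polynomial is the Hermitian square. -/
lemma exists_mem_coneW_matPoly_eq (s : ℕ) (w : (Fin (t + 1) → Fin n) → ℂ) :
    ∃ W ∈ coneW n t s, matPoly W = partialForm n t s w * polyConj (partialForm n t s w) := by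
  have hP := Matrix.posSemidef_vecMulVec_self_star (star w)
  refine ⟨partialTranspose s (Matrix.vecMulVec (star w) (star (star w))),
    ⟨partialTranspose_isHermitian s hP.1, ?_⟩, ?_⟩
  · rw [partialTranspose_partialTranspose]
    exact hP
  · rw [partialForm_mul_polyConj, matPoly, ← sum_swapReg s]
    refine Finset.sum_congr rfl fun i _ => Finset.sum_congr rfl fun j _ => ?_
    simp [partialTranspose_apply, Matrix.vecMulVec_apply, smul_eq_C_mul]

lemma exists_coneW_of_mem_squareCone {p : CPoly n} (hp : p ∈ squareCone n t) :
    ∃ W : Fin ((t + 1) / 2 + 1) → TensorMat n (t + 1),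
      (∀ s, W s ∈ coneW n t s.val) ∧ matPoly (∑ s, W s) = p := by
  induction hp using AddSubmonoid.closure_induction with
  | mem p hp =>
    obtain ⟨s, hs, w, rfl⟩ := hp
    obtain ⟨X, hX, hXp⟩ := exists_mem_coneW_matPoly_eq s w
    refine ⟨Pi.single ⟨s, by omega⟩ X, fun r => ?_, ?_⟩
    · rcases eq_or_ne r ⟨s, by omega⟩ with rfl | hr
      · rwa [Pi.single_eq_same]
      · rw [Pi.single_eq_of_ne hr]
        exact zero_mem_coneW _
    · rw [Finset.sum_pi_single', if_pos (Finset.mem_univ _), hXp]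
  | zero => exact ⟨0, fun s => zero_mem_coneW _, by simp [matPoly_zero]⟩
  | add p q _ _ hp hq =>
    obtain ⟨W, hW, rfl⟩ := hp
    obtain ⟨V, hV, rfl⟩ := hq
    refine ⟨W + V, fun s => add_mem_coneW (hW s) (hV s), ?_⟩
    rw [← matPoly_add, ← Finset.sum_add_distrib]
    rfl

lemma mem_hermPerp_of_matPoly_eq_zero {B : TensorMat n k} (hB : B.IsHermitian)
    (h : matPoly B = 0) : B ∈ hermPerp (boseSym n k) :=
  ⟨hB, fun R hR => by
    rw [traceInner_eq_re_apply_matPoly (momentFunctional_pairMono hR), h, map_zero,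
      Complex.zero_re]⟩

end BoseDPS

end

/-! ### Assembling the equivalence -/

theorem theorem4p1 (n t : ℕ) (ht : 1 ≤ t) (M : BoseDPS.BipMat n) (hM : M.IsHermitian) :
    List.TFAE
      [ M ∈ BoseDPS.dualCone (BoseDPS.symDPS n t),
        BoseDPS.IsRSOS (BoseDPS.normSqPoly n ^ (t - 1) * BoseDPS.formPoly M),
        ∃ (B : BoseDPS.TensorMat n (t + 1))
          (W : Fin ((t + 1) / 2 + 1) → BoseDPS.TensorMat n (t + 1)),
          B ∈ BoseDPS.hermPerp (BoseDPS.boseSym n (t + 1)) ∧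
          (∀ s, W s ∈ BoseDPS.coneW n t s.val) ∧
          BoseDPS.tensorId t M = B + ∑ s, W s ] := by
  open BoseDPS in
  -- Writing the order as `t + 1` removes the truncated subtraction in `t - 1`.
  obtain ⟨t, rfl⟩ := Nat.exists_eq_add_of_le' ht
  have hpoly : matPoly (tensorId (t + 1) M) = normSqPoly n ^ (t + 1 - 1) * formPoly M :=
    matPoly_tensorId M
  have hherm := tensorId_isHermitian (t := t) hM
  rw [← hpoly]
  have hcone : M ∈ dualCone (symDPS n (t + 1)) →
      matPoly (tensorId (t + 1) M) ∈ squareCone n (t + 1) := fun h =>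
    mem_squareCone_of_dual (matPoly_mem_bihom _) (polyConj_matPoly hherm) fun F hF hpos => by
      have := h.2 _ (partialTrace_momentMatrix_mem_symDPS hF hpos)
      rwa [traceInner_tensorId, traceInner_eq_re_apply_matPoly (F := F)
        (R := momentMatrix (t + 1 + 1) F) fun _ _ => rfl] at this
  tfae_have 1 → 2 := fun h => isRSOS_of_mem_squareCone (hcone h)
  tfae_have 1 → 3 := fun h => by
    obtain ⟨W, hW, hWp⟩ := exists_coneW_of_mem_squareCone (hcone h)
    -- `M ⊗ I` and `∑ W s` have the same polynomial, so their difference is orthogonal to all Bose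
    -- symmetric matrices.
    refine ⟨tensorId (t + 1) M - ∑ s, W s, W, ?_, hW, (sub_add_cancel _ _).symm⟩
    refine mem_hermPerp_of_matPoly_eq_zero (hherm.sub ?_) (by rw [matPoly_sub, hWp, sub_self])
    exact Finset.sum_induction W Matrix.IsHermitian (fun _ _ ha hb => ha.add hb)
      Matrix.isHermitian_zero fun s _ => (hW s).1
  tfae_have 2 → 1 := by
    rintro ⟨m, q, hq, hsum⟩
    refine ⟨hM, ?_⟩
    rintro _ ⟨-, R, hR, hpos, rfl⟩
    have hhom := matPoly_isHomogeneous (tensorId (t + 1) M)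
    rw [traceInner_tensorId, traceInner_eq_re_apply_matPoly (momentFunctional_pairMono hR), hsum]
    rw [hsum] at hhom
    exact (Complex.le_def.mp (momentFunctional_sum_sq_nonneg ht hR hpos hq hhom)).1
  tfae_have 3 → 1 := by
    rintro ⟨B, W, hB, hW, heq⟩
    refine ⟨hM, ?_⟩
    rintro _ ⟨-, R, hR, hpos, rfl⟩
    have hF := momentFunctional_pairMono hR
    rw [traceInner_tensorId, traceInner_eq_re_apply_matPoly hF, heq, matPoly_add, map_add,
      Complex.add_re, ← traceInner_eq_re_apply_matPoly hF, hB.2 R hR, zero_add, matPoly_sum,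
      map_sum, Complex.re_sum]
    refine Finset.sum_nonneg fun s _ => ?_
    rw [← traceInner_eq_re_apply_matPoly hF]
    exact traceInner_nonneg_of_mem_coneW (hW s) (hpos s (by omega))
  tfae_finish
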